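/- **Theorem 3.1.** Let $s\in(0,1)$, $b\in\mathbb{R}^n$ and $0<\lambda\le\Lambda$. Let $K$ be a nonnegative function in $L^1_{\rm loc}(\mathbb{R}^n\setminus\{0\})$ or, more generally, a nonnegative Radon measure on $\mathbb{R}^n\setminus\{0\}$ (written $K(y)\,dy$), positively homogeneous of degree $-n-2s$; for a measure this means $K(rA)=r^{-2s}K(A)$ for all $r>0$ and all Borel sets $A$. Write $K(\theta)\,d\theta$ for its trace on $S^{n-1}$, that is, in polar coordinates $y=r\theta$ one has $K(y)\,dy=r^{-1-2s}\,dr\,K(\theta)\,d\theta$. Assume that $$\lambda\le\inf_{\nu\in S^{n-1}}\int_{S^{n-1}}|\nu\cdot\theta|^{2s}K(\theta)\,d\theta,\qquad \int_{S^{n-1}}K(\theta)\,d\theta\le\Lambda,$$ and, when $s=\tfrac12$, also that $\int_{S^{n-1}}\theta\,K(\theta)\,d\theta=0$. Let $$Lu(x)=\begin{cases}\displaystyle\int_{\mathbb{R}^n}\big(u(x)-u(x+y)\big)K(y)\,dy & \text{if } s\in(0,\tfrac12),\\[2mm] \displaystyle{\rm P.V.}\int_{\mathbb{R}^n}\big(u(x)-u(x+y)\big)K(y)\,dy+b\cdot\nabla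 u(x) & \text{if } s=\tfrac12,\\[2mm] \displaystyle\int_{\mathbb{R}^n}\big(u(x)-u(x+y)+\nabla u(x)\cdot y\big)K(y)\,dy & \text{if } s\in(\tfrac12,1),\end{cases}$$ and let $L^*$ be the operator of the same form with $K(y)$ replaced by $K(-y)$ and $b$ by $-b$. Let $u\in L^\infty(\mathbb{R}^n)$ be a weak solution of $Lu=0$ in $\mathbb{R}^n$, that is, $$\int_{\mathbb{R}^n}u(x)\,L^*\eta(x)\,dx=0\qquad\text{for every }\eta\in C^\infty_c(\mathbb{R}^n).$$ Then $u$ is constant (that is, $u$ agrees almost everywhere with a constant). -/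

import Mathlib

open MeasureTheory Filter Topology
open scoped ContDiff

namespace StableOp

noncomputable section

/-- `μ` is a (possibly singular) Lévy kernel on `ℝⁿ ∖ {0}` which is positively homogeneous of degree
`-n-2s`. A kernel given by a function `K ∈ L¹_loc(ℝⁿ ∖ {0})` is the measure `μ = K(y) dy`, and
`K(r y) = r^(-n-2s) K(y)` then says that `μ(r A) = r^(-2s) μ(A)`. -/
structure IsHomogeneousKernel {n : ℕ} (s : ℝ) (μ : Measure (EuclideanSpace ℝ (Fin n))) : Prop where
  zero : μ {0} = 0
  finite_of_isCompact : ∀ C : Set (EuclideanSpace ℝ (Fin n)), IsCompact C → 0 ∉ C → μ C < ⊤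
  homogeneous : ∀ r : ℝ, 0 < r → ∀ A : Set (EuclideanSpace ℝ (Fin n)), MeasurableSet A →
    μ ((fun y => r • y) '' A) = ENNReal.ofReal (r ^ (-(2 * s))) * μ A

/-- The spherical part `K(θ) dθ` of a homogeneous kernel `μ`, as a measure on `ℝⁿ` carried by the
unit sphere. In polar coordinates `μ = r^(-1-2s) dr ⊗ K(θ) dθ`, and `∫_1^∞ r^(-1-2s) dr = 1/(2s)`;
so `K(θ) dθ` is `2s` times the image of `μ` restricted to `{|y| ≥ 1}` under `y ↦ y/|y|`. -/
def spherePart {n : ℕ} (s : ℝ) (μ : Measure (EuclideanSpace ℝ (Fin n))) :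
    Measure (EuclideanSpace ℝ (Fin n)) :=
  ENNReal.ofReal (2 * s) • (μ.restrict {y | 1 ≤ ‖y‖}).map (fun y => ‖y‖⁻¹ • y)

/-- `λ ≤ inf_{|ν| = 1} ∫ |ν·θ|^{2s} K(θ) dθ` and `∫ K(θ) dθ ≤ Λ`, with `0 < λ ≤ Λ`. -/
structure IsElliptic {n : ℕ} (s lam Lam : ℝ) (μ : Measure (EuclideanSpace ℝ (Fin n))) : Prop where
  pos : 0 < lam
  le : lam ≤ Lam
  lower : ∀ ν : EuclideanSpace ℝ (Fin n), ‖ν‖ = 1 →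
    ENNReal.ofReal lam ≤ ∫⁻ θ, ENNReal.ofReal (|inner ℝ ν θ| ^ (2 * s)) ∂(spherePart s μ)
  upper : spherePart s μ Set.univ ≤ ENNReal.ofReal Lam

/-- All the assumptions on the kernel of the operator: homogeneity, the cancellation property
`∫ θ K(θ) dθ = 0` when `s = 1/2`, and ellipticity. -/
structure IsStableKernel {n : ℕ} (s lam Lam : ℝ) (μ : Measure (EuclideanSpace ℝ (Fin n))) :
    Prop where
  homogeneousKernel : IsHomogeneousKernel s μ
  cancellation : s = 1 / 2 → ∫ θ, θ ∂(spherePart s μ) = 0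
  elliptic : IsElliptic s lam Lam μ

/-- The principal value `lim_{ε → 0⁺} ∫_{|y| ≥ ε} g(y) dμ(y)`. -/
def principalValue {n : ℕ} (μ : Measure (EuclideanSpace ℝ (Fin n)))
    (g : EuclideanSpace ℝ (Fin n) → ℝ) : ℝ :=
  limUnder (𝓝[>] (0 : ℝ)) (fun ε => ∫ y in {y | ε ≤ ‖y‖}, g y ∂μ)

/-- The operator `L` with kernel `μ` and drift `b` (which is used only when `s = 1/2`), pointwise.
Here `∇u(x)·y` is `fderiv ℝ u x y`. For a kernel as in `IsStableKernel` and `u ∈ C_c^∞`, all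
integrals converge absolutely and the principal value exists. -/
def op {n : ℕ} (s : ℝ) (b : EuclideanSpace ℝ (Fin n)) (μ : Measure (EuclideanSpace ℝ (Fin n)))
    (u : EuclideanSpace ℝ (Fin n) → ℝ) (x : EuclideanSpace ℝ (Fin n)) : ℝ :=
  if s < 1 / 2 then ∫ y, (u x - u (x + y)) ∂μ
  else if s = 1 / 2 then principalValue μ (fun y => u x - u (x + y)) + fderiv ℝ u x b
  else ∫ y, (u x - u (x + y) + fderiv ℝ u x y) ∂μ

/-- The adjoint kernel `K* = K_e - K_o`, that is `K*(y) = K(-y)`. -/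
def adjointKernel {n : ℕ} (μ : Measure (EuclideanSpace ℝ (Fin n))) :
    Measure (EuclideanSpace ℝ (Fin n)) :=
  μ.map (fun y => -y)

/-- The adjoint operator `L*`: the kernel is `K*` and the drift is `-b`. -/
def adjointOp {n : ℕ} (s : ℝ) (b : EuclideanSpace ℝ (Fin n))
    (μ : Measure (EuclideanSpace ℝ (Fin n))) (u : EuclideanSpace ℝ (Fin n) → ℝ) :
    EuclideanSpace ℝ (Fin n) → ℝ :=
  op s (-b) (adjointKernel μ) u

/-- `Lu = f` in `Ω` in the weak sense: `∫ u L*η = ∫_Ω f η` for every `η ∈ C_c^∞(Ω)`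
(for `u ∈ L^∞(ℝⁿ)` and `f ∈ L^∞(Ω)`). -/
def IsWeakSolution {n : ℕ} (s : ℝ) (b : EuclideanSpace ℝ (Fin n))
    (μ : Measure (EuclideanSpace ℝ (Fin n))) (Ω : Set (EuclideanSpace ℝ (Fin n)))
    (u f : EuclideanSpace ℝ (Fin n) → ℝ) : Prop :=
  ∀ η : EuclideanSpace ℝ (Fin n) → ℝ, ContDiff ℝ ∞ η → HasCompactSupport η → tsupport η ⊆ Ω →
    ∫ x, u x * adjointOp s b μ η x = ∫ x in Ω, f x * η x

end

end StableOp

/-! Mollification reduces the theorem to f = u * φ, which is bounded with bounded gradient and a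
uniform second-order Taylor estimate, and which solves Lf = 0 pointwise (`levyOp_integral_mul`). On
such functions L is a Lévy operator with compensator cut off at the unit ball and a constant drift
(`exists_op_eq_levyOp`).

The core is `BoundedC11.apply_add_eq_of_levyOp_eq_zero`: f is invariant under translation by every
y₀ in the support of μ. Put d(x) = f(x + y₀) - f(x). Since L annihilates f and d, L(f²) = -Γ(f) and
L(d²) = -Γ(d) ≤ 0, where Γ(g)(x) = ∫ (g(x+y) - g(x))² dμ(y). For y near y₀ the integrand of Γ(f) is
close to d², so Γ(f) dominates a multiple of d² up to a small error. The maximum principle for z + T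
Lz (`BoundedC11.le_of_add_levyOp_le`), applied to z = f² + cT d², bounds d² by O(1/T) plus that
error; T → ∞ and then a shrinking neighbourhood of y₀ give d = 0.

By homogeneity the support is a cone, so ∇f(x) vanishes on it, and ellipticity allows only the zero
functional to do so. Every mollification is thus constant, and an approximate identity recovers u.
-/

namespace StableOp

/-! ### Lévy operators on bounded functions: carré du champ, maximum principle, translation
invariance. -/

section LevyOperator

variable {E : Type*} [NormedAddCommGroup E] [NormedSpace ℝ E]

/-- Bounded functions with bounded derivative and a uniform second order Taylor estimate. -/
structure BoundedC11 (C : ℝ) (f : E → ℝ) : Prop where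
  differentiable : Differentiable ℝ f
  bound : ∀ x, |f x| ≤ C
  fderiv_bound : ∀ x, ‖fderiv ℝ f x‖ ≤ C
  taylor : ∀ x y, ‖y‖ < 1 → |f (x + y) - f x - fderiv ℝ f x y| ≤ C * ‖y‖ ^ 2

namespace BoundedC11

variable {C D : ℝ} {f g : E → ℝ}

lemma nonneg (hf : BoundedC11 C f) : 0 ≤ C := (abs_nonneg _).trans (hf.bound 0)

lemma abs_sub_le (hf : BoundedC11 C f) (x y : E) (hy : ‖y‖ < 1) :
    |f (x + y) - f x| ≤ 2 * C * ‖y‖ := by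
  have h1 := abs_le.1 (hf.taylor x y hy)
  have h2 : |fderiv ℝ f x y| ≤ C * ‖y‖ :=
    ((fderiv ℝ f x).le_opNorm y).trans (by gcongr; exact hf.fderiv_bound x)
  have h3 := abs_le.1 h2
  have h4 : C * ‖y‖ ^ 2 ≤ C * ‖y‖ := by
    have := hf.nonneg
    gcongr
    nlinarith [norm_nonneg y]
  rw [abs_le]
  constructor <;> linarith [h1.1, h1.2, h3.1, h3.2]

lemma add (hf : BoundedC11 C f) (hg : BoundedC11 D g) :
    BoundedC11 (C + D) (fun x => f x + g x) where
  differentiable := hf.differentiable.add hg.differentiable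
  bound x := (abs_add_le _ _).trans (add_le_add (hf.bound x) (hg.bound x))
  fderiv_bound x := by
    rw [fderiv_fun_add (hf.differentiable x) (hg.differentiable x)]
    exact (norm_add_le _ _).trans (add_le_add (hf.fderiv_bound x) (hg.fderiv_bound x))
  taylor x y hy := by
    rw [fderiv_fun_add (hf.differentiable x) (hg.differentiable x), add_apply]
    have h := (abs_add_le _ _).trans (add_le_add (hf.taylor x y hy) (hg.taylor x y hy))
    rw [add_mul]
    refine le_of_eq_of_le ?_ h
    congr 1
    ring

lemma const_mul (hf : BoundedC11 C f) (a : ℝ) : BoundedC11 (|a| * C) (fun x => a * f x) where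
  differentiable := hf.differentiable.const_mul a
  bound x := by
    rw [abs_mul]
    exact mul_le_mul_of_nonneg_left (hf.bound x) (abs_nonneg a)
  fderiv_bound x := by
    rw [fderiv_const_mul (hf.differentiable x), norm_smul, Real.norm_eq_abs]
    exact mul_le_mul_of_nonneg_left (hf.fderiv_bound x) (abs_nonneg a)
  taylor x y hy := by
    rw [fderiv_const_mul (hf.differentiable x), smul_apply, smul_eq_mul,
      mul_assoc, ← mul_sub, ← mul_sub, abs_mul]
    exact mul_le_mul_of_nonneg_left (hf.taylor x y hy) (abs_nonneg a)

lemma comp_add_right (hf : BoundedC11 C f) (a : E) : BoundedC11 C (fun x => f (x + a)) where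
  differentiable := hf.differentiable.comp (differentiable_id.add_const a)
  bound x := hf.bound _
  fderiv_bound x := by
    rw [fderiv_comp_add_right]
    exact hf.fderiv_bound _
  taylor x y hy := by
    rw [fderiv_comp_add_right, add_right_comm]
    exact hf.taylor _ y hy

lemma fderiv_sq (hf : BoundedC11 C f) (x : E) :
    fderiv ℝ (fun x => f x ^ 2) x = (2 * f x) • fderiv ℝ f x := by
  rw [fderiv_fun_pow 2 (hf.differentiable x)]
  simp

/-- The Taylor remainder of f² is (f(x+y) - f(x))² plus 2f(x) times the remainder of f; these
contribute 4C² and 2C², whence the 6. -/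
lemma sq (hf : BoundedC11 C f) : BoundedC11 (6 * C ^ 2) (fun x => f x ^ 2) where
  differentiable := hf.differentiable.pow 2
  bound x := by
    rw [abs_pow]
    have : |f x| ^ 2 ≤ C ^ 2 := by gcongr; exact hf.bound x
    nlinarith [sq_nonneg C]
  fderiv_bound x := by
    rw [hf.fderiv_sq, norm_smul, Real.norm_eq_abs, abs_mul, abs_two]
    have := mul_le_mul (hf.bound x) (hf.fderiv_bound x) (norm_nonneg _) hf.nonneg
    nlinarith [sq_nonneg C]
  taylor x y hy := by
    rw [hf.fderiv_sq, smul_apply, smul_eq_mul]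
    have h1 : |(f (x + y) - f x) ^ 2| ≤ (2 * C * ‖y‖) ^ 2 := by
      rw [abs_pow]
      gcongr
      exact hf.abs_sub_le x y hy
    have h2 : |2 * f x * (f (x + y) - f x - fderiv ℝ f x y)| ≤ 2 * C * (C * ‖y‖ ^ 2) := by
      rw [abs_mul, abs_mul, abs_two]
      have := hf.nonneg
      gcongr
      · exact hf.bound x
      · exact hf.taylor x y hy
    have h3 := (abs_add_le _ _).trans (add_le_add h1 h2)
    refine (le_of_eq ?_).trans (h3.trans (le_of_eq ?_))
    · congr 1
      ring
    · ring

lemma of_contDiff_of_hasCompactSupport [ProperSpace E] (hf : ContDiff ℝ ∞ f)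
    (hc : HasCompactSupport f) : ∃ C, BoundedC11 C f := by
  obtain ⟨C₀, h₀⟩ := hc.exists_bound_of_continuous hf.continuous
  have hf' : ContDiff ℝ 1 (fderiv ℝ f) := hf.fderiv_right (by norm_cast)
  obtain ⟨C₁, h₁⟩ := (hc.fderiv ℝ).exists_bound_of_continuous hf'.continuous
  obtain ⟨C₂, h₂⟩ := hf'.lipschitzWith_of_hasCompactSupport (hc.fderiv ℝ) one_ne_zero
  have hd : Differentiable ℝ f := hf.differentiable (by simp)
  have k₂ : (0 : ℝ) ≤ C₂ := C₂.2
  refine ⟨max (max C₀ C₁) C₂, hd, fun x => ?_, fun x => ?_, fun x y _ => ?_⟩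
  · exact (h₀ x).trans ((le_max_left _ _).trans (le_max_left _ _))
  · exact (h₁ x).trans ((le_max_right _ _).trans (le_max_left _ _))
  · have h := (convex_segment x (x + y)).norm_image_sub_le_of_norm_fderiv_le' (𝕜 := ℝ) (f := f)
      (φ := fderiv ℝ f x) (C := C₂ * ‖y‖) (fun z _ => hd z) (fun z hz => ?_)
      (left_mem_segment ℝ x (x + y)) (right_mem_segment ℝ x (x + y))
    · rw [add_sub_cancel_left, Real.norm_eq_abs] at h
      refine h.trans ?_
      rw [mul_assoc, ← pow_two]
      gcongr
      exact le_max_right _ _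
    · have h3 := h₂.dist_le_mul z x
      rw [dist_eq_norm, dist_eq_norm] at h3
      refine h3.trans ?_
      gcongr
      have := norm_sub_le_of_mem_segment hz
      simpa using this

end BoundedC11

/-- The Taylor estimate serves for |y| < 1 and the sup bound for |y| ≥ 1, so the Lévy condition on μ
makes the integrand of `levyOp` integrable. -/
lemma BoundedC11.abs_increment_le {C : ℝ} {f : E → ℝ} (hf : BoundedC11 C f) (x y : E) :
    |f x - f (x + y) + (Metric.ball (0 : E) 1).indicator (fun y => fderiv ℝ f x y) y|
      ≤ 2 * C * min 1 (‖y‖ ^ 2) := by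
  have hC := hf.nonneg
  by_cases hy : ‖y‖ < 1
  · rw [Set.indicator_of_mem (by simpa using hy), min_eq_right (by nlinarith [norm_nonneg y])]
    have h := hf.taylor x y hy
    rw [← abs_neg] at h
    refine (le_of_eq ?_).trans (h.trans ?_)
    · congr 1
      ring
    · nlinarith [sq_nonneg ‖y‖, mul_nonneg hC (sq_nonneg ‖y‖)]
  · rw [Set.indicator_of_notMem (by simpa using hy),
      min_eq_left (by nlinarith [norm_nonneg y, not_lt.1 hy])]
    have h1 := abs_le.1 (hf.bound x)
    have h2 := abs_le.1 (hf.bound (x + y))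
    rw [abs_le]
    constructor <;> linarith [h1.1, h1.2, h2.1, h2.2]

variable [MeasurableSpace E]

/-- The operator `f(x) - f(x+y) + 1_{|y|<1} ∇f(x)·y` integrated against `μ`, with drift `B`. -/
noncomputable def levyOp (B : E) (μ : Measure E) (f : E → ℝ) (x : E) : ℝ :=
  ∫ y, (f x - f (x + y) + (Metric.ball (0 : E) 1).indicator (fun y => fderiv ℝ f x y) y) ∂μ
    + fderiv ℝ f x B

variable {B : E} {μ : Measure E} {C D : ℝ} {f g : E → ℝ}

lemma BoundedC11.levyOp_const_mul (hf : BoundedC11 C f) (a : ℝ) (x : E) :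
    levyOp B μ (fun x => a * f x) x = a * levyOp B μ f x := by
  simp only [levyOp]
  rw [fderiv_const_mul (hf.differentiable x), mul_add, ← integral_const_mul,
    smul_apply, smul_eq_mul]
  congr 1
  refine integral_congr_ae (.of_forall fun y => ?_)
  by_cases hy : y ∈ Metric.ball (0 : E) 1
  · simp only [Set.indicator_of_mem hy, smul_apply, smul_eq_mul]
    ring
  · simp only [Set.indicator_of_notMem hy]
    ring

lemma levyOp_comp_add_right (f : E → ℝ) (a x : E) :
    levyOp B μ (fun x => f (x + a)) x = levyOp B μ f (x + a) := by
  simp only [levyOp, fderiv_comp_add_right, add_right_comm]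

/-- The gradient vanishes at a maximum, which removes both the drift and the compensator and leaves
a nonnegative integrand. -/
lemma levyOp_nonneg_of_isMax {x : E} (h : ∀ y, f y ≤ f x) : 0 ≤ levyOp B μ f x := by
  have h0 : fderiv ℝ f x = 0 := IsLocalMax.fderiv_eq_zero (Eventually.of_forall h)
  simp only [levyOp, h0, zero_apply, Set.indicator_zero, add_zero]
  exact integral_nonneg fun y => sub_nonneg.2 (h _)

lemma BoundedC11.exists_levyOp_bound (hf : BoundedC11 C f) (B : E)
    (hμ : Integrable (fun y : E => min 1 (‖y‖ ^ 2)) μ) :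
    ∃ A, ∀ x, |levyOp B μ f x| ≤ A := by
  refine ⟨∫ y, 2 * C * min 1 (‖y‖ ^ 2) ∂μ + C * ‖B‖, fun x => ?_⟩
  refine (abs_add_le _ _).trans (add_le_add ?_ ?_)
  · exact norm_integral_le_of_norm_le (hμ.const_mul (2 * C))
      (.of_forall fun y => (Real.norm_eq_abs _).trans_le (hf.abs_increment_le x y))
  · exact ((fderiv ℝ f x).le_opNorm B).trans
      (mul_le_mul_of_nonneg_right (hf.fderiv_bound x) (norm_nonneg B))

variable [BorelSpace E]

lemma BoundedC11.integrable_increment (hf : BoundedC11 C f)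
    (hμ : Integrable (fun y : E => min 1 (‖y‖ ^ 2)) μ) (x : E) :
    Integrable (fun y => f x - f (x + y) +
      (Metric.ball (0 : E) 1).indicator (fun y => fderiv ℝ f x y) y) μ := by
  refine (hμ.const_mul (2 * C)).mono' ?_ (.of_forall fun y => ?_)
  · have h1 : Measurable f := hf.differentiable.continuous.measurable
    have h2 : Measurable fun y => fderiv ℝ f x y := (fderiv ℝ f x).continuous.measurable
    have h3 : Measurable fun y => f (x + y) :=
      (hf.differentiable.continuous.comp (continuous_const.add continuous_id)).measurable
    exact ((measurable_const.sub h3).add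
      (h2.indicator Metric.isOpen_ball.measurableSet)).aestronglyMeasurable
  · exact hf.abs_increment_le x y

lemma BoundedC11.integrable_sq_sub (hf : BoundedC11 C f)
    (hμ : Integrable (fun y : E => min 1 (‖y‖ ^ 2)) μ) (x : E) :
    Integrable (fun y => (f (x + y) - f x) ^ 2) μ := by
  refine (hμ.const_mul (4 * C ^ 2)).mono' ?_ (.of_forall fun y => ?_)
  · have h3 : Continuous fun y => f (x + y) :=
      hf.differentiable.continuous.comp (continuous_const.add continuous_id)
    exact ((h3.sub continuous_const).pow 2).measurable.aestronglyMeasurable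
  · have hC := hf.nonneg
    rw [Real.norm_eq_abs, abs_pow]
    by_cases hy : ‖y‖ < 1
    · rw [min_eq_right (by nlinarith [norm_nonneg y])]
      calc |f (x + y) - f x| ^ 2 ≤ (2 * C * ‖y‖) ^ 2 := by gcongr; exact hf.abs_sub_le x y hy
        _ = _ := by ring
    · rw [min_eq_left (by nlinarith [norm_nonneg y, not_lt.1 hy])]
      calc |f (x + y) - f x| ^ 2 ≤ (C + C) ^ 2 := by
            gcongr
            exact (abs_sub _ _).trans (add_le_add (hf.bound _) (hf.bound _))
        _ = _ := by ring

lemma BoundedC11.levyOp_add (hf : BoundedC11 C f) (hg : BoundedC11 D g)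
    (hμ : Integrable (fun y : E => min 1 (‖y‖ ^ 2)) μ) (x : E) :
    levyOp B μ (fun x => f x + g x) x = levyOp B μ f x + levyOp B μ g x := by
  have h := integral_add (hf.integrable_increment hμ x) (hg.integrable_increment hμ x)
  simp only [levyOp]
  rw [fderiv_fun_add (hf.differentiable x) (hg.differentiable x), add_apply]
  rw [add_add_add_comm, ← h]
  congr 1
  refine integral_congr_ae (.of_forall fun y => ?_)
  by_cases hy : y ∈ Metric.ball (0 : E) 1
  · simp only [Set.indicator_of_mem hy, add_apply]
    ring
  · simp only [Set.indicator_of_notMem hy]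
    ring

/-- The carré du champ identity. -/
lemma BoundedC11.levyOp_sq (hf : BoundedC11 C f)
    (hμ : Integrable (fun y : E => min 1 (‖y‖ ^ 2)) μ) (x : E) :
    levyOp B μ (fun x => f x ^ 2) x
      = 2 * f x * levyOp B μ f x - ∫ y, (f (x + y) - f x) ^ 2 ∂μ := by
  simp only [levyOp]
  rw [hf.fderiv_sq, mul_add, ← integral_const_mul, smul_apply, smul_eq_mul,
    add_sub_right_comm,
    ← integral_sub ((hf.integrable_increment hμ x).const_mul _) (hf.integrable_sq_sub hμ x)]
  congr 1
  refine integral_congr_ae (.of_forall fun y => ?_)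
  by_cases hy : y ∈ Metric.ball (0 : E) 1
  · simp only [Set.indicator_of_mem hy, smul_apply, smul_eq_mul]
    ring
  · simp only [Set.indicator_of_notMem hy]
    ring

/-- Maximum principle for the resolvent equation. -/
lemma BoundedC11.le_of_add_levyOp_le [FiniteDimensional ℝ E] [HasContDiffBump E]
    (hf : BoundedC11 C f) (hμ : Integrable (fun y : E => min 1 (‖y‖ ^ 2)) μ) {T A : ℝ} (hT : 0 ≤ T)
    (h : ∀ x, f x + T * levyOp B μ f x ≤ A) (x : E) : f x ≤ A := by
  obtain ⟨ψ⟩ : Nonempty (ContDiffBump (0 : E)) := inferInstance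
  obtain ⟨Cψ, hψ⟩ := BoundedC11.of_contDiff_of_hasCompactSupport (f := ψ) ψ.contDiff
    ψ.hasCompactSupport
  obtain ⟨A', hA'⟩ := hψ.exists_levyOp_bound B hμ
  have hbdd : BddAbove (Set.range f) := ⟨C, by
    rintro _ ⟨y, rfl⟩
    exact (abs_le.1 (hf.bound y)).2⟩
  set S := ⨆ y, f y with hS
  have hfS : ∀ y, f y ≤ S := fun y => le_ciSup hbdd y
  -- The supremum of f need not be attained. A bump of height 2δ at a point where f > S - δ lifts
  -- the value there above S + δ, while f ≤ S off the bump, so the perturbed function attains its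
  -- maximum. The bump changes L by at most 2δA'.
  have key : ∀ δ > 0, S ≤ A + δ * (1 + 2 * T * A') := by
    intro δ hδ
    obtain ⟨x₀, hx₀⟩ := exists_lt_of_lt_ciSup (show S - δ < ⨆ y, f y by rw [← hS]; linarith)
    set p : E → ℝ := fun x => (2 * δ) * ψ (x + -x₀)
    have hp : BoundedC11 (|2 * δ| * Cψ) p := (hψ.comp_add_right (-x₀)).const_mul (2 * δ)
    have hz := hf.add hp
    obtain ⟨x₁, hx₁, hmax⟩ := (isCompact_closedBall x₀ ψ.rOut).exists_isMaxOn
      (Metric.nonempty_closedBall.2 ψ.rOut_pos.le) hz.differentiable.continuous.continuousOn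
    have hval : S + δ < f x₀ + p x₀ := by
      simp only [p, add_neg_cancel]
      rw [ψ.one_of_mem_closedBall (by simp [ψ.rIn_pos.le])]
      linarith
    have hx₀₁ : f x₀ + p x₀ ≤ f x₁ + p x₁ :=
      hmax (Metric.mem_closedBall_self ψ.rOut_pos.le)
    have hglob : ∀ y, f y + p y ≤ f x₁ + p x₁ := by
      intro y
      by_cases hy : y ∈ Metric.closedBall x₀ ψ.rOut
      · exact hmax hy
      · have : p y = 0 := by
          simp only [p]
          rw [ψ.zero_of_le_dist, mul_zero]
          rw [Metric.mem_closedBall, not_le, dist_eq_norm] at hy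
          rw [dist_zero_right, ← sub_eq_add_neg]
          exact hy.le
        linarith [hfS y]
    have hL : 0 ≤ levyOp B μ (fun x => f x + p x) x₁ :=
      levyOp_nonneg_of_isMax (f := fun x => f x + p x) hglob
    rw [hf.levyOp_add hp hμ] at hL
    simp only [p] at hL
    rw [(hψ.comp_add_right (-x₀)).levyOp_const_mul, levyOp_comp_add_right] at hL
    have h1 := (abs_le.1 (hA' (x₁ + -x₀))).2
    have h2 : p x₁ ≤ 2 * δ := by
      have := ψ.le_one (x := x₁ + -x₀)
      simp only [p]
      nlinarith
    have h3 : -(2 * δ * A') ≤ levyOp B μ f x₁ := by nlinarith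
    have h4 := mul_le_mul_of_nonneg_left h3 hT
    linarith [h x₁]
  have hSA : S ≤ A := by
    have ht : Tendsto (fun δ : ℝ => A + δ * (1 + 2 * T * A')) (𝓝[>] 0)
        (𝓝 (A + 0 * (1 + 2 * T * A'))) :=
      (Continuous.tendsto (by fun_prop) 0).mono_left nhdsWithin_le_nhds
    rw [zero_mul, add_zero] at ht
    exact ge_of_tendsto ht (eventually_mem_nhdsWithin.mono fun δ hδ => key δ hδ)
  exact (hfS x).trans hSA

/-- A bounded solution of `Lf = 0` on the whole space is invariant under translations by the
elements of the support of the kernel. -/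
lemma BoundedC11.apply_add_eq_of_levyOp_eq_zero [FiniteDimensional ℝ E] [HasContDiffBump E]
    (hf : BoundedC11 C f) (hμ : Integrable (fun y : E => min 1 (‖y‖ ^ 2)) μ)
    (h0 : ∀ x, levyOp B μ f x = 0) {y₀ : E} (hy₀ : ∀ r > 0, 0 < μ (Metric.ball y₀ r)) (x : E) :
    f (x + y₀) = f x := by
  rcases eq_or_ne y₀ 0 with rfl | hne
  · rw [add_zero]
  have hC := hf.nonneg
  have hd := (hf.comp_add_right y₀).add (hf.const_mul (-1))
  set d : E → ℝ := fun x => f (x + y₀) + -1 * f x with hd_def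
  have hd0 : ∀ x, levyOp B μ d x = 0 := fun x => by
    rw [(hf.comp_add_right y₀).levyOp_add (hf.const_mul (-1)) hμ, hf.levyOp_const_mul,
      levyOp_comp_add_right, h0, h0]
    simp
  -- r < 1 permits the Lipschitz estimate near y₀; r ≤ ‖y₀‖/2 keeps the ball away from the origin,
  -- so that its mass is finite.
  have key : ∀ r, 0 < r → r < 1 → r ≤ ‖y₀‖ / 2 → ∀ T > 0,
      d x ^ 2 ≤ 2 * C ^ 2 / (T * μ.real (Metric.ball y₀ r)) + 8 * C ^ 2 * r ^ 2 := by
    intro r hr hr1 hr2 T hT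
    have hfin : μ (Metric.ball y₀ r) < ⊤ := by
      have hpos : 0 < min 1 ((‖y₀‖ / 2) ^ 2) := by positivity
      refine lt_of_le_of_lt (measure_mono fun y hy => ?_) (hμ.measure_ge_lt_top hpos)
      rw [mem_ball_iff_norm'] at hy
      have : ‖y₀‖ / 2 ≤ ‖y‖ := by linarith [norm_sub_norm_le y₀ y]
      simp only [Set.mem_ofPred_eq]
      gcongr
    set m := μ.real (Metric.ball y₀ r) with hm_def
    have hm : 0 < m := ENNReal.toReal_pos (hy₀ r hr).ne' hfin.ne
    have hΓ : ∀ x, m * (d x ^ 2 / 2 - 4 * C ^ 2 * r ^ 2) ≤ ∫ y, (f (x + y) - f x) ^ 2 ∂μ := by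
      intro x
      have hint := hf.integrable_sq_sub hμ x
      calc m * (d x ^ 2 / 2 - 4 * C ^ 2 * r ^ 2)
          = ∫ _ in Metric.ball y₀ r, (d x ^ 2 / 2 - 4 * C ^ 2 * r ^ 2) ∂μ := by
            rw [setIntegral_const, smul_eq_mul]
        _ ≤ ∫ y in Metric.ball y₀ r, (f (x + y) - f x) ^ 2 ∂μ := by
            refine setIntegral_mono_on (integrableOn_const hfin.ne) hint.integrableOn
              Metric.isOpen_ball.measurableSet fun y hy => ?_
            rw [mem_ball_iff_norm] at hy
            have h1 := hf.abs_sub_le (x + y₀) (y - y₀) (hy.trans hr1)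
            rw [show x + y₀ + (y - y₀) = x + y by abel] at h1
            have h2 : |f (x + y) - f (x + y₀)| ≤ 2 * C * r := h1.trans (by gcongr)
            have h3 : (f (x + y) - f (x + y₀)) ^ 2 ≤ (2 * C * r) ^ 2 := sq_le_sq' (abs_le.1 h2).1
              (abs_le.1 h2).2
            simp only [hd_def]
            -- With P = f(x+y) - f(x) and Q = f(x+y) - f(x+y₀) one has d = P - Q, hence d² ≤ 2P² +
            -- 2Q².
            nlinarith [sq_nonneg ((f (x + y) - f x) + (f (x + y) - f (x + y₀)))]
        _ ≤ ∫ y, (f (x + y) - f x) ^ 2 ∂μ :=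
            setIntegral_le_integral hint (.of_forall fun y => sq_nonneg _)
    -- The weight Tm/2 makes the term in d² cancel exactly against the lower bound for T Γ(f).
    have hz := hf.sq.add (hd.sq.const_mul (T * m / 2))
    have hmax := hz.le_of_add_levyOp_le (B := B) hμ (T := T) (A := C ^ 2 + 4 * T * m * C ^ 2 * r ^ 2)
      hT.le (fun x => ?_) x
    · rw [div_add' _ _ _ (by positivity), le_div_iff₀ (by positivity)]
      nlinarith [sq_nonneg (f x)]
    · rw [hf.sq.levyOp_add (hd.sq.const_mul _) hμ, hd.sq.levyOp_const_mul, hf.levyOp_sq hμ,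
        hd.levyOp_sq hμ, h0, hd0]
      have h1 : f x ^ 2 ≤ C ^ 2 := sq_le_sq' (abs_le.1 (hf.bound x)).1 (abs_le.1 (hf.bound x)).2
      have h2 : 0 ≤ ∫ y, (d (x + y) - d x) ^ 2 ∂μ := integral_nonneg fun y => sq_nonneg _
      have h3 := mul_le_mul_of_nonneg_left (hΓ x) hT.le
      have h4 : 0 ≤ T * (T * m / 2 * ∫ y, (d (x + y) - d x) ^ 2 ∂μ) := by positivity
      linarith
  have key2 : ∀ r, 0 < r → r < 1 → r ≤ ‖y₀‖ / 2 → d x ^ 2 ≤ 8 * C ^ 2 * r ^ 2 := by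
    intro r hr hr1 hr2
    set m := μ.real (Metric.ball y₀ r)
    have ht : Tendsto (fun T : ℝ => 2 * C ^ 2 / (T * m) + 8 * C ^ 2 * r ^ 2) atTop
        (𝓝 (2 * C ^ 2 / m * 0 + 8 * C ^ 2 * r ^ 2)) := by
      refine ((tendsto_inv_atTop_zero.const_mul (2 * C ^ 2 / m)).add_const _).congr fun T => ?_
      rw [← div_eq_mul_inv, div_div, mul_comm m]
    rw [mul_zero, zero_add] at ht
    exact ge_of_tendsto ht ((eventually_gt_atTop 0).mono fun T hT => key r hr hr1 hr2 T hT)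
  have hdx : d x ^ 2 ≤ 0 := by
    have ht : Tendsto (fun r : ℝ => 8 * C ^ 2 * r ^ 2) (𝓝[>] 0) (𝓝 (8 * C ^ 2 * 0 ^ 2)) :=
      (Continuous.tendsto (by fun_prop) 0).mono_left nhdsWithin_le_nhds
    rw [zero_pow two_ne_zero, mul_zero] at ht
    have hpos : 0 < ‖y₀‖ / 2 := by positivity
    refine ge_of_tendsto ht ?_
    filter_upwards [Ioo_mem_nhdsGT one_pos, Ioo_mem_nhdsGT hpos] with r h1 h2
    exact key2 r h1.1 h1.2 h2.2.le
  have := pow_eq_zero_iff two_ne_zero |>.1 (le_antisymm hdx (sq_nonneg _))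
  simp only [hd_def] at this
  linarith

end LevyOperator

/-! ### Pairing an essentially bounded function with an integrable one. -/

section EssentiallyBounded

variable {X : Type*} [MeasureSpace X] {u : X → ℝ} {M : ℝ}

lemma integrable_mul_of_ae_bound (hu : AEStronglyMeasurable u) (hM : ∀ᵐ z, |u z| ≤ M) {g : X → ℝ}
    (hg : Integrable g) : Integrable (fun z => u z * g z) :=
  hg.bdd_mul hu hM

lemma abs_integral_mul_le_of_ae_bound (hM : ∀ᵐ z, |u z| ≤ M) {g : X → ℝ} (hg : Integrable g) :
    |∫ z, u z * g z| ≤ M * ∫ z, |g z| := by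
  rw [← integral_const_mul]
  refine norm_integral_le_of_norm_le (f := fun z => u z * g z) (hg.abs.const_mul M) ?_
  filter_upwards [hM] with z hz
  rw [norm_mul]
  exact mul_le_mul_of_nonneg_right hz (abs_nonneg _)

end EssentiallyBounded

/-! ### Mollification: regularity, and commutation with the Lévy operator. -/

section Convolution

variable {E : Type*} [NormedAddCommGroup E] [NormedSpace ℝ E]
  [MeasureSpace E] [BorelSpace E] [(volume : Measure E).IsAddHaarMeasure]
  {u φ : E → ℝ} {M : ℝ}

section TestFunction

variable (hφ : ContDiff ℝ ∞ φ) (hc : HasCompactSupport φ)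
include hφ hc

lemma integrable_fderiv_apply (y : E) : Integrable fun z => fderiv ℝ φ z y := by
  refine Continuous.integrable_of_hasCompactSupport ?_ ?_
  · exact (hφ.continuous_fderiv (by simp)).clm_apply continuous_const
  · exact (hc.fderiv ℝ).comp_left (g := fun L : E →L[ℝ] ℝ => L y) rfl

lemma integrable_increment_left (y : E) : Integrable fun z => φ z - φ (z + y) +
    (Metric.ball (0 : E) 1).indicator (fun y => fderiv ℝ φ z y) y := by
  have h := hφ.continuous.integrable_of_hasCompactSupport (μ := volume) hc
  refine (h.sub (h.comp_add_right y)).add ?_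
  by_cases hy : y ∈ Metric.ball (0 : E) 1
  · simp only [Set.indicator_of_mem hy]
    exact integrable_fderiv_apply hφ hc y
  · simp only [Set.indicator_of_notMem hy]
    exact integrable_zero _ _ _

variable [FiniteDimensional ℝ E]

/-- For |y| < 1 the increment lives on a fixed ball and is pointwise O(|y|²); for |y| ≥ 1 the
triangle inequality gives 2‖φ‖₁. Paired with a bounded u, this L¹ bound yields both the Taylor
estimate for u * φ and the domination needed for Fubini. -/
lemma exists_integral_abs_increment_le : ∃ A, 0 ≤ A ∧ ∀ y, ∫ z, |φ z - φ (z + y) +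
    (Metric.ball (0 : E) 1).indicator (fun y => fderiv ℝ φ z y) y| ≤ A * min 1 (‖y‖ ^ 2) := by
  obtain ⟨C, hC⟩ := BoundedC11.of_contDiff_of_hasCompactSupport hφ hc
  obtain ⟨R, hR⟩ := hc.isCompact.isBounded.subset_closedBall (0 : E)
  have hint := hφ.continuous.integrable_of_hasCompactSupport (μ := volume) hc
  have hC0 := hC.nonneg
  have hI : 0 ≤ ∫ z, |φ z| := integral_nonneg fun z => abs_nonneg _
  refine ⟨2 * C * volume.real (Metric.closedBall (0 : E) (R + 1)) + 2 * ∫ z, |φ z|,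
    by positivity, fun y => ?_⟩
  rw [add_mul]
  by_cases hy : ‖y‖ < 1
  · have h1 : ∫ z, |φ z - φ (z + y) +
        (Metric.ball (0 : E) 1).indicator (fun y => fderiv ℝ φ z y) y| ≤
        ∫ z, (Metric.closedBall (0 : E) (R + 1)).indicator
          (fun _ => 2 * C * min 1 (‖y‖ ^ 2)) z := by
      refine integral_mono (integrable_increment_left hφ hc y).abs
        ((integrable_indicator_iff Metric.isClosed_closedBall.measurableSet).2
          (integrableOn_const measure_closedBall_lt_top.ne)) fun z => ?_
      by_cases hz : z ∈ Metric.closedBall (0 : E) (R + 1)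
      · rw [Set.indicator_of_mem hz]
        exact hC.abs_increment_le z y
      · rw [Set.indicator_of_notMem hz]
        rw [mem_closedBall_zero_iff, not_le] at hz
        have h2 : z ∉ tsupport φ := fun h => by
          have := mem_closedBall_zero_iff.1 (hR h)
          linarith
        have h3 : z + y ∉ tsupport φ := fun h => by
          have := mem_closedBall_zero_iff.1 (hR h)
          have := norm_sub_le (z + y) y
          rw [add_sub_cancel_right] at this
          linarith
        have h4 : fderiv ℝ φ z = 0 := by
          by_contra hne
          exact h2 (support_fderiv_subset ℝ hne)
        simp [image_eq_zero_of_notMem_tsupport h2, image_eq_zero_of_notMem_tsupport h3, h4]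
    rw [integral_indicator Metric.isClosed_closedBall.measurableSet, setIntegral_const,
      smul_eq_mul] at h1
    have : 0 ≤ 2 * (∫ z, |φ z|) * min 1 (‖y‖ ^ 2) := by positivity
    nlinarith
  · rw [min_eq_left (by nlinarith [norm_nonneg y, not_lt.1 hy])]
    simp only [Set.indicator_of_notMem (show y ∉ Metric.ball (0 : E) 1 by simpa using hy),
      add_zero, mul_one]
    have h1 : ∫ z, |φ z - φ (z + y)| ≤ ∫ z, (|φ z| + |φ (z + y)|) :=
      integral_mono (hint.sub (hint.comp_add_right y)).abs
        (hint.abs.add (hint.comp_add_right y).abs) fun z => abs_sub _ _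
    rw [integral_add hint.abs (hint.comp_add_right y).abs,
      integral_add_right_eq_self (fun z => |φ z|) y] at h1
    have : 0 ≤ 2 * C * volume.real (Metric.closedBall (0 : E) (R + 1)) := by positivity
    linarith

variable (hu : AEStronglyMeasurable u) (hM : ∀ᵐ z, |u z| ≤ M)
include hu hM

lemma hasFDerivAt_integral_mul (x : E) : HasFDerivAt (fun x => ∫ z, u z * φ (x - z))
    (convolution u (fderiv ℝ φ)
      ((ContinuousLinearMap.mul ℝ ℝ).precompR E) volume x) x := by
  have hu' : LocallyIntegrable u :=
    (memLp_top_of_bound hu M hM).locallyIntegrable le_top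
  exact hc.hasFDerivAt_convolution_right (ContinuousLinearMap.mul ℝ ℝ) hu'
    (hφ.of_le (by norm_cast)) x

lemma fderiv_integral_mul_apply (x y : E) :
    fderiv ℝ (fun x => ∫ z, u z * φ (x - z)) x y = ∫ z, u z * fderiv ℝ φ (x - z) y := by
  have hu' : LocallyIntegrable u :=
    (memLp_top_of_bound hu M hM).locallyIntegrable le_top
  rw [(hasFDerivAt_integral_mul hφ hc hu hM x).fderiv,
    convolution_precompR_apply _ hu' (hc.fderiv ℝ) (hφ.continuous_fderiv (by simp))]
  rfl

lemma increment_integral_mul (x y : E) :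
    (∫ z, u z * φ (x - z)) - (∫ z, u z * φ (x + y - z)) + (Metric.ball (0 : E) 1).indicator
      (fun y => fderiv ℝ (fun x => ∫ z, u z * φ (x - z)) x y) y =
    ∫ z, u z * (φ (x - z) - φ (x - z + y) +
      (Metric.ball (0 : E) 1).indicator (fun y => fderiv ℝ φ (x - z) y) y) := by
  have hint := hφ.continuous.integrable_of_hasCompactSupport (μ := volume) hc
  have i1 := integrable_mul_of_ae_bound hu hM (hint.comp_sub_left x)
  have i2 := integrable_mul_of_ae_bound hu hM (hint.comp_sub_left (x + y))
  have i3 := integrable_mul_of_ae_bound hu hM ((integrable_fderiv_apply hφ hc y).comp_sub_left x)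
  by_cases hy : y ∈ Metric.ball (0 : E) 1
  · simp only [Set.indicator_of_mem hy]
    rw [fderiv_integral_mul_apply hφ hc hu hM, ← integral_sub i1 i2]
    refine (integral_add (i1.sub i2) i3).symm.trans ?_
    refine integral_congr_ae (.of_forall fun z => ?_)
    simp only [Pi.sub_apply, sub_add_eq_add_sub]
    ring
  · simp only [Set.indicator_of_notMem hy]
    rw [← integral_sub i1 i2, add_zero]
    refine integral_congr_ae (.of_forall fun z => ?_)
    simp only [sub_add_eq_add_sub]
    ring

/-- All derivatives and increments fall on φ, so each bound is an L^∞–L¹ pairing; u needs no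
regularity. -/
lemma exists_boundedC11_integral_mul :
    ∃ C, BoundedC11 C (fun x => ∫ z, u z * φ (x - z)) := by
  obtain ⟨A, hA0, hA⟩ := exists_integral_abs_increment_le hφ hc
  have hM0 : 0 ≤ M := by
    obtain ⟨z, hz⟩ := hM.exists
    exact (abs_nonneg _).trans hz
  have hint := hφ.continuous.integrable_of_hasCompactSupport (μ := volume) hc
  have hint' : Integrable (fderiv ℝ φ) :=
    (hφ.continuous_fderiv (by simp)).integrable_of_hasCompactSupport (hc.fderiv ℝ)
  refine ⟨max (max (M * ∫ z, |φ z|) (M * ∫ z, ‖fderiv ℝ φ z‖)) (M * A),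
    fun x => (hasFDerivAt_integral_mul hφ hc hu hM x).differentiableAt, fun x => ?_, fun x => ?_,
    fun x y hy => ?_⟩
  · refine le_trans ?_ ((le_max_left _ _).trans (le_max_left _ _))
    refine (abs_integral_mul_le_of_ae_bound hM (hint.comp_sub_left x)).trans (le_of_eq ?_)
    rw [integral_sub_left_eq_self (fun z => |φ z|) volume x]
  · refine le_trans ?_ ((le_max_right _ _).trans (le_max_left _ _))
    have hN : 0 ≤ ∫ z, ‖fderiv ℝ φ z‖ := integral_nonneg fun z => norm_nonneg _
    refine ContinuousLinearMap.opNorm_le_bound _ (by positivity) fun y => ?_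
    rw [fderiv_integral_mul_apply hφ hc hu hM, Real.norm_eq_abs]
    have hi := integrable_fderiv_apply hφ hc y
    refine (abs_integral_mul_le_of_ae_bound hM (hi.comp_sub_left x)).trans ?_
    rw [integral_sub_left_eq_self (fun z => |fderiv ℝ φ z y|) volume x, mul_assoc,
      ← integral_mul_const]
    refine mul_le_mul_of_nonneg_left ?_ hM0
    refine integral_mono (f := fun z => |fderiv ℝ φ z y|) hi.abs (hint'.norm.mul_const _)
      fun z => (fderiv ℝ φ z).le_opNorm y
  · have h := increment_integral_mul hφ hc hu hM x y
    rw [Set.indicator_of_mem (by simpa using hy)] at h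
    have hi := integrable_increment_left hφ hc y
    have h2 := abs_integral_mul_le_of_ae_bound hM (hi.comp_sub_left x)
    rw [← h, integral_sub_left_eq_self (fun z => |φ z - φ (z + y) +
      (Metric.ball (0 : E) 1).indicator (fun y => fderiv ℝ φ z y) y|) volume x, ← abs_neg] at h2
    have h3 := h2.trans (mul_le_mul_of_nonneg_left (hA y) hM0)
    rw [min_eq_right (by nlinarith [norm_nonneg y]), ← mul_assoc] at h3
    refine (le_of_eq ?_).trans (h3.trans ?_)
    · congr 1
      ring
    · gcongr
      exact le_max_right _ _

lemma levyOp_integral_mul (B : E) {μ : Measure E} [SFinite μ]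
    (hμ : Integrable (fun y : E => min 1 (‖y‖ ^ 2)) μ) (x : E) :
    levyOp B μ (fun x => ∫ z, u z * φ (x - z)) x = ∫ z, u z * levyOp B μ φ (x - z) := by
  obtain ⟨A, hA0, hA⟩ := exists_integral_abs_increment_le hφ hc
  have hM0 : 0 ≤ M := by
    obtain ⟨z, hz⟩ := hM.exists
    exact (abs_nonneg _).trans hz
  have hmeas : Measurable fun p : E × E => φ (x - p.2) - φ (x - p.2 + p.1) +
      (Metric.ball (0 : E) 1).indicator (fun y => fderiv ℝ φ (x - p.2) y) p.1 := by
    have h1 : Continuous φ := hφ.continuous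
    have h2 : Continuous (fderiv ℝ φ) := hφ.continuous_fderiv (by simp)
    have h3 : Continuous fun p : E × E => fderiv ℝ φ (x - p.2) p.1 :=
      (h2.comp (continuous_const.sub continuous_snd)).clm_apply continuous_fst
    have h4 : Continuous fun p : E × E => φ (x - p.2) - φ (x - p.2 + p.1) := by fun_prop
    exact h4.measurable.add (h3.measurable.indicator
      (measurable_fst Metric.isOpen_ball.measurableSet))
  -- Fubini is justified by integrating in z first: the result is at most M A min(1, |y|²), which is
  -- μ-integrable.
  have hF : Integrable (Function.uncurry fun y z => u z * (φ (x - z) - φ (x - z + y) +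
      (Metric.ball (0 : E) 1).indicator (fun y => fderiv ℝ φ (x - z) y) y)) (μ.prod volume) := by
    refine (integrable_prod_iff (hu.comp_snd.mul hmeas.aestronglyMeasurable)).2
      ⟨.of_forall fun y => integrable_mul_of_ae_bound hu hM
        ((integrable_increment_left hφ hc y).comp_sub_left x), ?_⟩
    refine (hμ.const_mul (M * A)).mono'
      (hu.comp_snd.mul hmeas.aestronglyMeasurable).norm.integral_prod_right'
      (.of_forall fun y => ?_)
    have hi := (integrable_increment_left hφ hc y).comp_sub_left x
    have h1 := abs_integral_mul_le_of_ae_bound (u := fun z => |u z|) (M := M)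
      (by simpa using hM) hi.abs
    simp only [abs_abs] at h1
    rw [integral_sub_left_eq_self (fun z => |φ z - φ (z + y) +
      (Metric.ball (0 : E) 1).indicator (fun y => fderiv ℝ φ z y) y|) volume x] at h1
    have h3 := h1.trans (mul_le_mul_of_nonneg_left (hA y) hM0)
    rw [← mul_assoc] at h3
    rw [Real.norm_eq_abs]
    simpa only [Real.norm_eq_abs, Pi.mul_apply, abs_mul] using h3
  have hi1 : Integrable fun z => u z * ∫ y, (φ (x - z) - φ (x - z + y) +
      (Metric.ball (0 : E) 1).indicator (fun y => fderiv ℝ φ (x - z) y) y) ∂μ := by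
    simpa only [Function.uncurry, integral_const_mul] using hF.integral_prod_right
  have hi2 := integrable_mul_of_ae_bound hu hM ((integrable_fderiv_apply hφ hc B).comp_sub_left x)
  have hincr := increment_integral_mul hφ hc hu hM x
  simp only [levyOp, hincr]
  rw [fderiv_integral_mul_apply hφ hc hu hM]
  simp only [mul_add (u _) (∫ y, _ ∂μ)]
  rw [integral_add hi1 hi2]
  congr 1
  rw [integral_integral_swap hF]
  simp only [integral_const_mul]

end TestFunction

end Convolution

/-! ### Homogeneous kernels: moments, cancellation, and reduction to Lévy form. -/

section Kernel

variable {n : ℕ} {s : ℝ} {μ : Measure (EuclideanSpace ℝ (Fin n))}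

local notation "𝔼" => EuclideanSpace ℝ (Fin n)

namespace IsHomogeneousKernel

lemma map_inv_smul (hμ : IsHomogeneousKernel s μ) {a : ℝ} (ha : 0 < a) :
    μ.map (fun y => a⁻¹ • y) = ENNReal.ofReal (a ^ (-(2 * s))) • μ := by
  ext A hA
  rw [Measure.map_apply (measurable_const_smul _) hA, Measure.smul_apply, smul_eq_mul,
    ← hμ.homogeneous a ha A hA]
  congr 1
  exact (congrFun (Set.image_eq_preimage_of_inverse (inv_smul_smul₀ ha.ne')
    (smul_inv_smul₀ ha.ne')) A).symm

lemma integral_comp_inv_smul {F : Type*} [NormedAddCommGroup F] [NormedSpace ℝ F]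
    (hμ : IsHomogeneousKernel s μ) {a : ℝ} (ha : 0 < a) (g : 𝔼 → F) :
    ∫ y, g (a⁻¹ • y) ∂μ = a ^ (-(2 * s)) • ∫ y, g y ∂μ := by
  have h := (measurableEmbedding_const_smul₀ (α := 𝔼) (inv_ne_zero ha.ne')).integral_map (μ := μ) g
  rw [← h, hμ.map_inv_smul ha, integral_smul_measure,
    ENNReal.toReal_ofReal (Real.rpow_nonneg ha.le _)]

/-- The integral of `|y|^p` over the dilates `a^k S` of the annulus `S = {1/2 ≤ |y| ≤ 2}` is
controlled by a geometric series. -/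
lemma lintegral_norm_pow_iUnion_lt_top (hμ : IsHomogeneousKernel s μ) {a : ℝ} (ha : 0 < a) (p : ℕ)
    (h : a ^ p * a ^ (-(2 * s)) < 1) :
    ∫⁻ y in ⋃ k : ℕ, (fun y : 𝔼 => a ^ k • y) '' {y | 1 / 2 ≤ ‖y‖ ∧ ‖y‖ ≤ 2},
      ENNReal.ofReal (‖y‖ ^ p) ∂μ < ⊤ := by
  set S : Set 𝔼 := {y | 1 / 2 ≤ ‖y‖ ∧ ‖y‖ ≤ 2} with hS_def
  have hSc : IsClosed S :=
    (isClosed_le continuous_const continuous_norm).inter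
      (isClosed_le continuous_norm continuous_const)
  have hS : IsCompact S := (isCompact_closedBall (0 : 𝔼) 2).of_isClosed_subset hSc
    fun y hy => by simpa using hy.2
  have hμS : μ S < ⊤ := hμ.finite_of_isCompact S hS (by simp [hS_def])
  have hbound : ∀ k : ℕ, ∫⁻ y in (fun y : 𝔼 => a ^ k • y) '' S, ENNReal.ofReal (‖y‖ ^ p) ∂μ ≤
      ENNReal.ofReal (2 ^ p) * μ S * ENNReal.ofReal (a ^ p * a ^ (-(2 * s))) ^ k := by
    intro k
    have hk : 0 < a ^ k := pow_pos ha k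
    have hmeas : MeasurableSet ((fun y : 𝔼 => a ^ k • y) '' S) :=
      (measurableEmbedding_const_smul₀ hk.ne').measurableSet_image.2 hSc.measurableSet
    calc ∫⁻ y in (fun y : 𝔼 => a ^ k • y) '' S, ENNReal.ofReal (‖y‖ ^ p) ∂μ
        ≤ ∫⁻ _ in (fun y : 𝔼 => a ^ k • y) '' S, ENNReal.ofReal ((a ^ k * 2) ^ p) ∂μ := by
          refine setLIntegral_mono' hmeas ?_
          rintro _ ⟨y, hy, rfl⟩
          refine ENNReal.ofReal_le_ofReal ?_
          simp only [norm_smul, norm_pow, Real.norm_eq_abs, abs_of_pos ha]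
          gcongr
          exact hy.2
      _ = ENNReal.ofReal ((a ^ k * 2) ^ p) *
            (ENNReal.ofReal ((a ^ k) ^ (-(2 * s))) * μ S) := by
          rw [setLIntegral_const, hμ.homogeneous _ hk S hSc.measurableSet]
      _ = _ := by
          rw [← ENNReal.ofReal_pow (by positivity), mul_pow, mul_comm (_ ^ p) (2 ^ p : ℝ),
            ENNReal.ofReal_mul (by positivity), mul_pow, ENNReal.ofReal_mul (by positivity),
            ← Real.rpow_natCast (a ^ (-(2 * s))) k, ← Real.rpow_mul ha.le,
            ← Real.rpow_natCast a k, ← Real.rpow_mul ha.le, mul_comm (k : ℝ) (-(2 * s)),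
            Real.rpow_natCast, pow_right_comm]
          ring
  -- The dilated annuli overlap, so only countable subadditivity is used; the geometric ratio is
  -- a^(p - 2s).
  refine (lintegral_iUnion_le _ _).trans_lt ?_
  refine (ENNReal.tsum_le_tsum hbound).trans_lt ?_
  rw [ENNReal.tsum_mul_left, ENNReal.tsum_geometric]
  refine ENNReal.mul_lt_top (ENNReal.mul_lt_top ENNReal.ofReal_lt_top hμS) ?_
  rw [ENNReal.inv_lt_top, tsub_pos_iff_lt, ENNReal.ofReal_lt_one]
  exact h

/-- Dilating the annulus by powers of 1/2 covers the punctured ball, and the origin is a null set.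
-/
lemma integrableOn_norm_pow_ball (hμ : IsHomogeneousKernel s μ) (p : ℕ) (hp : 2 * s < p) :
    IntegrableOn (fun y : 𝔼 => ‖y‖ ^ p) (Metric.ball 0 1) μ := by
  have hq : (1 / 2 : ℝ) ^ p * (1 / 2 : ℝ) ^ (-(2 * s)) < 1 := by
    rw [← Real.rpow_natCast, ← Real.rpow_add (by norm_num)]
    exact Real.rpow_lt_one (by norm_num) (by norm_num) (by linarith)
  have h := hμ.lintegral_norm_pow_iUnion_lt_top one_half_pos p hq
  refine ⟨(continuous_norm.pow p).aestronglyMeasurable, ?_⟩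
  rw [hasFiniteIntegral_iff_ofReal (.of_forall fun y => by positivity)]
  refine (lintegral_mono_set fun y hy => ?_).trans_lt ((lintegral_union_le _ {(0 : 𝔼)} _).trans_lt
    (ENNReal.add_lt_top.2 ⟨(setLIntegral_measure_zero _ _ hμ.zero).trans_lt ENNReal.zero_lt_top, h⟩))
  rcases eq_or_ne y 0 with rfl | hne
  · exact Or.inl rfl
  · right
    have hpos : 0 < ‖y‖ := norm_pos_iff.2 hne
    obtain ⟨k, hk1, hk2⟩ := exists_nat_pow_near_of_lt_one hpos (mem_ball_zero_iff.1 hy).le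
      one_half_pos one_half_lt_one
    refine Set.mem_iUnion.2 ⟨k, ((1 / 2 : ℝ) ^ k)⁻¹ • y, ?_, smul_inv_smul₀ (by positivity) y⟩
    have hk : (0 : ℝ) < (1 / 2) ^ k := by positivity
    simp only [Set.mem_ofPred_eq, norm_smul, norm_inv, Real.norm_eq_abs, abs_of_pos hk]
    rw [inv_mul_eq_div, le_div_iff₀ hk, div_le_iff₀ hk]
    rw [pow_succ] at hk1
    constructor <;> linarith

/-- Here the dilations are by powers of 2. Taking p = 0 gives finite mass away from the origin, and
p = 1 a first moment at infinity when s > 1/2. -/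
lemma integrableOn_norm_pow_compl_ball (hμ : IsHomogeneousKernel s μ) (p : ℕ) (hp : p < 2 * s) :
    IntegrableOn (fun y : 𝔼 => ‖y‖ ^ p) (Metric.ball 0 1)ᶜ μ := by
  have hq : (2 : ℝ) ^ p * (2 : ℝ) ^ (-(2 * s)) < 1 := by
    rw [← Real.rpow_natCast, ← Real.rpow_add (by norm_num)]
    exact Real.rpow_lt_one_of_one_lt_of_neg (by norm_num) (by linarith)
  have h := hμ.lintegral_norm_pow_iUnion_lt_top two_pos p hq
  refine ⟨(continuous_norm.pow p).aestronglyMeasurable, ?_⟩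
  rw [hasFiniteIntegral_iff_ofReal (.of_forall fun y => by positivity)]
  refine (lintegral_mono_set fun y hy => ?_).trans_lt h
  have hy1 : 1 ≤ ‖y‖ := by simpa using hy
  obtain ⟨k, hk1, hk2⟩ := exists_nat_pow_near hy1 one_lt_two
  refine Set.mem_iUnion.2 ⟨k, ((2 : ℝ) ^ k)⁻¹ • y, ?_, smul_inv_smul₀ (by positivity) y⟩
  have hk : (0 : ℝ) < 2 ^ k := by positivity
  simp only [Set.mem_ofPred_eq, norm_smul, norm_inv, Real.norm_eq_abs, abs_of_pos hk]
  rw [inv_mul_eq_div, le_div_iff₀ hk, div_le_iff₀ hk]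
  rw [pow_succ] at hk2
  constructor <;> linarith

lemma integrable_min_one_norm_sq (hμ : IsHomogeneousKernel s μ) (hs : s ∈ Set.Ioo (0 : ℝ) 1) :
    Integrable (fun y : 𝔼 => min 1 (‖y‖ ^ 2)) μ := by
  rw [← integrableOn_univ, ← Set.union_compl_self (Metric.ball (0 : 𝔼) 1)]
  refine IntegrableOn.union ?_ ?_
  · refine (hμ.integrableOn_norm_pow_ball 2 (by push_cast; linarith [hs.2])).congr_fun
      (fun y hy => ?_) Metric.isOpen_ball.measurableSet
    rw [mem_ball_zero_iff] at hy
    simp only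
    rw [min_eq_right (by nlinarith [norm_nonneg y])]
  · refine (hμ.integrableOn_norm_pow_compl_ball 0 (by push_cast; linarith [hs.1])).congr_fun
      (fun y hy => ?_) Metric.isOpen_ball.measurableSet.compl
    have hy1 : 1 ≤ ‖y‖ := by simpa using hy
    simp only
    rw [min_eq_left (by nlinarith [norm_nonneg y]), pow_zero]

lemma measure_le_norm_lt_top (hμ : IsHomogeneousKernel s μ) (hs : s ∈ Set.Ioo (0 : ℝ) 1) {ε : ℝ}
    (hε : 0 < ε) : μ {y | ε ≤ ‖y‖} < ⊤ := by
  refine lt_of_le_of_lt (measure_mono fun y hy => ?_)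
    ((hμ.integrable_min_one_norm_sq hs).measure_ge_lt_top (ε := min 1 (ε ^ 2)) (by positivity))
  have hy : ε ≤ ‖y‖ := hy
  simp only [Set.mem_ofPred_eq]
  gcongr

lemma sigmaFinite (hμ : IsHomogeneousKernel s μ) (hs : s ∈ Set.Ioo (0 : ℝ) 1) : SigmaFinite μ := by
  refine ⟨⟨⟨fun k : ℕ => {0} ∪ {y | 1 / ((k : ℝ) + 1) ≤ ‖y‖}, fun k => trivial, fun k => ?_, ?_⟩⟩⟩
  · refine (measure_union_le _ _).trans_lt (ENNReal.add_lt_top.2 ⟨?_, ?_⟩)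
    · rw [hμ.zero]
      exact ENNReal.zero_lt_top
    · exact hμ.measure_le_norm_lt_top hs (by positivity)
  · refine Set.eq_univ_of_forall fun y => Set.mem_iUnion.2 ?_
    rcases eq_or_ne y 0 with rfl | hne
    · exact ⟨0, Or.inl rfl⟩
    · obtain ⟨k, hk⟩ := exists_nat_one_div_lt (norm_pos_iff.2 hne)
      exact ⟨k, Or.inr hk.le⟩

end IsHomogeneousKernel

namespace IsStableKernel

variable {lam Lam : ℝ}

/-- The cancellation hypothesis is the case a = 1; since y/|y| is invariant under dilation,
homogeneity carries it to every radius. -/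
lemma integral_direction_eq_zero (hμ : IsStableKernel s lam Lam μ) (hs : s = 1 / 2) {a : ℝ}
    (ha : 0 < a) : ∫ y in {y | a ≤ ‖y‖}, ‖y‖⁻¹ • y ∂μ = 0 := by
  have hmeas : ∀ a : ℝ, MeasurableSet {y : 𝔼 | a ≤ ‖y‖} := fun a =>
    measurableSet_le measurable_const measurable_norm
  have h1 : ∫ y in {y : 𝔼 | 1 ≤ ‖y‖}, ‖y‖⁻¹ • y ∂μ = 0 := by
    have h := hμ.cancellation hs
    rw [spherePart, integral_smul_measure, integral_map (by fun_prop) (by fun_prop), hs] at h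
    simpa using h
  have h2 := hμ.homogeneousKernel.integral_comp_inv_smul ha
    ({y : 𝔼 | 1 ≤ ‖y‖}.indicator fun y => ‖y‖⁻¹ • y)
  rw [integral_indicator (hmeas 1), h1, smul_zero] at h2
  rw [← integral_indicator (hmeas a), ← h2]
  refine integral_congr_ae (.of_forall fun y => ?_)
  have hiff : y ∈ {y : 𝔼 | a ≤ ‖y‖} ↔ a⁻¹ • y ∈ {y : 𝔼 | 1 ≤ ‖y‖} := by
    simp only [Set.mem_ofPred_eq, norm_smul, norm_inv, Real.norm_eq_abs, abs_of_pos ha]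
    rw [inv_mul_eq_div, le_div_iff₀ ha, one_mul]
  by_cases hy : y ∈ {y : 𝔼 | a ≤ ‖y‖}
  · simp only [Set.indicator_of_mem hy, Set.indicator_of_mem (hiff.1 hy), norm_smul, norm_inv,
      Real.norm_eq_abs, abs_of_pos ha, smul_smul, mul_inv, inv_inv]
    congr 1
    field_simp
  · simp only [Set.indicator_of_notMem hy, Set.indicator_of_notMem (mt hiff.2 hy)]

/-- Layer cake replaces a polar decomposition of μ: for |y| < 1, y is the integral over t in (0, 1]
of 1_{t ≤ |y|} y/|y|. After Fubini each slice is empty or a difference of two exterior regions, on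
both of which the direction field integrates to zero. -/
lemma integral_annulus_eq_zero (hμ : IsStableKernel s lam Lam μ) (hs : s = 1 / 2) {ε : ℝ}
    (hε : 0 < ε) : ∫ y in {y | ε ≤ ‖y‖} ∩ Metric.ball 0 1, y ∂μ = 0 := by
  have hs' : s ∈ Set.Ioo (0 : ℝ) 1 := by rw [hs]; norm_num
  have hmeas : ∀ a : ℝ, MeasurableSet {y : 𝔼 | a ≤ ‖y‖} := fun a =>
    measurableSet_le measurable_const measurable_norm
  set S : Set 𝔼 := {y | ε ≤ ‖y‖} ∩ Metric.ball 0 1 with hS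
  have hSm : MeasurableSet S := (hmeas ε).inter Metric.isOpen_ball.measurableSet
  have hfin : μ S < ⊤ :=
    (measure_mono Set.inter_subset_left).trans_lt (hμ.homogeneousKernel.measure_le_norm_lt_top hs' hε)
  have : IsFiniteMeasure (μ.restrict S) := isFiniteMeasure_restrict.2 hfin.ne
  have hdir : ∀ y : 𝔼, ‖‖y‖⁻¹ • y‖ ≤ 1 := fun y => by
    rw [norm_smul, norm_inv, norm_norm]
    exact inv_mul_le_one
  have hdirm : Measurable fun y : 𝔼 => ‖y‖⁻¹ • y := by fun_prop
  have key : ∀ t ∈ Set.Ioc (0 : ℝ) 1, ∫ y in S, {y : 𝔼 | t ≤ ‖y‖}.indicator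
      (fun y => ‖y‖⁻¹ • y) y ∂μ = 0 := by
    intro t ht
    set a := max t ε
    have ha : 0 < a := ht.1.trans_le (le_max_left _ _)
    have hint : ∀ c : ℝ, 0 < c → IntegrableOn (fun y : 𝔼 => ‖y‖⁻¹ • y) {y | c ≤ ‖y‖} μ := by
      intro c hc
      exact Measure.integrableOn_of_bounded
        (hμ.homogeneousKernel.measure_le_norm_lt_top hs' hc).ne
        hdirm.aestronglyMeasurable (M := 1) (.of_forall hdir)
    rw [setIntegral_indicator (hmeas t)]
    by_cases h1 : a ≤ 1
    · have hset : S ∩ {y : 𝔼 | t ≤ ‖y‖} = {y : 𝔼 | a ≤ ‖y‖} \ {y : 𝔼 | 1 ≤ ‖y‖} := by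
        ext y
        simp only [hS, Set.mem_inter_iff, Set.mem_ofPred_eq, mem_ball_zero_iff, Set.mem_sdiff, a,
          max_le_iff, not_le]
        tauto
      rw [hset, setIntegral_sdiff (hmeas 1) (hint a ha) (fun y hy => h1.trans hy),
        hμ.integral_direction_eq_zero hs ha, hμ.integral_direction_eq_zero hs one_pos, sub_zero]
    · have hset : S ∩ {y : 𝔼 | t ≤ ‖y‖} = ∅ := by
        ext y
        simp only [hS, Set.mem_inter_iff, Set.mem_ofPred_eq, mem_ball_zero_iff,
          Set.mem_empty_iff_false, iff_false]
        rintro ⟨⟨h2, h3⟩, h4⟩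
        exact h1 ((max_le h4 h2).trans h3.le)
      rw [hset, setIntegral_empty]
  have hF : Integrable (Function.uncurry fun (y : 𝔼) (t : ℝ) =>
      {y : 𝔼 | t ≤ ‖y‖}.indicator (fun y => ‖y‖⁻¹ • y) y)
      ((μ.restrict S).prod (volume.restrict (Set.Ioc (0 : ℝ) 1))) := by
    refine Integrable.of_bound (C := 1) ?_ (.of_forall fun p => ?_)
    · have : MeasurableSet {p : 𝔼 × ℝ | p.2 ≤ ‖p.1‖} :=
        measurableSet_le measurable_snd measurable_fst.norm
      exact ((hdirm.comp measurable_fst).indicator this).aestronglyMeasurable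
    · exact (norm_indicator_le_norm_self _ _).trans (hdir p.1)
  have hswap := integral_integral_swap hF
  rw [setIntegral_congr_fun measurableSet_Ioc key, integral_zero] at hswap
  rw [← hswap]
  refine setIntegral_congr_fun hSm fun y hy => ?_
  have hy0 : 0 < ‖y‖ := hε.trans_le hy.1
  have hy1 : ‖y‖ < 1 := mem_ball_zero_iff.1 hy.2
  have hcongr : ∀ t, {y : 𝔼 | t ≤ ‖y‖}.indicator (fun y => ‖y‖⁻¹ • y) y =
      (Set.Iic ‖y‖).indicator (fun _ => ‖y‖⁻¹ • y) t := fun t => by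
    simp only [Set.indicator, Set.mem_ofPred_eq, Set.mem_Iic]
  simp only [hcongr]
  rw [setIntegral_indicator measurableSet_Iic, setIntegral_const, Set.Ioc_inter_Iic,
    min_eq_right hy1.le, Real.volume_real_Ioc_of_le hy0.le, sub_zero, smul_smul,
    mul_inv_cancel₀ hy0.ne', one_smul]

/-- On smooth functions the operator is a Lévy operator with a suitable drift. -/
lemma exists_op_eq_levyOp (hμ : IsStableKernel s lam Lam μ) (hs : s ∈ Set.Ioo (0 : ℝ) 1) (b : 𝔼) :
    ∃ B : 𝔼, ∀ (C : ℝ) (f : 𝔼 → ℝ), BoundedC11 C f → ∀ x, op s b μ f x = levyOp B μ f x := by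
  have hκ := hμ.homogeneousKernel.integrable_min_one_norm_sq hs
  have hball : MeasurableSet (Metric.ball (0 : 𝔼) 1) := Metric.isOpen_ball.measurableSet
  rcases lt_trichotomy s (1 / 2) with hlt | heq | hgt
  · have hid : IntegrableOn (fun y : 𝔼 => y) (Metric.ball 0 1) μ := by
      refine (integrable_norm_iff continuous_id.aestronglyMeasurable).1 ?_
      simpa [IntegrableOn] using
        hμ.homogeneousKernel.integrableOn_norm_pow_ball 1 (by push_cast; linarith)
    -- For s < 1/2 the compensator is integrable by itself, and the drift takes it away again.
    refine ⟨-∫ y in Metric.ball (0 : 𝔼) 1, y ∂μ, fun C f hf x => ?_⟩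
    have hi : Integrable ((Metric.ball (0 : 𝔼) 1).indicator fun y => fderiv ℝ f x y) μ :=
      (integrable_indicator_iff hball).2 ((fderiv ℝ f x).integrable_comp hid)
    have hi2 : Integrable (fun y => f x - f (x + y)) μ := by
      refine ((hf.integrable_increment hκ x).sub hi).congr (.of_forall fun y => ?_)
      exact add_sub_cancel_right _ _
    rw [op, if_pos hlt, levyOp, integral_add hi2 hi, integral_indicator hball,
      (fderiv ℝ f x).integral_comp_comm hid, map_neg]
    ring
  -- For s = 1/2 the compensator integrates to zero on each truncated annulus, so it may be inserted
  -- before letting ε → 0; dominated convergence then evaluates the principal value.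
  · refine ⟨b, fun C f hf x => ?_⟩
    rw [op, if_neg heq.not_lt, if_pos heq, levyOp]
    congr 1
    refine Tendsto.limUnder_eq ?_
    have hG := hf.integrable_increment hκ x
    have hm : ∀ a : ℝ, MeasurableSet {y : 𝔼 | a ≤ ‖y‖} := fun a =>
      measurableSet_le measurable_const measurable_norm
    have hlim : Tendsto (fun ε : ℝ => ∫ y, {y : 𝔼 | ε ≤ ‖y‖}.indicator (fun y => f x - f (x + y) +
        (Metric.ball (0 : 𝔼) 1).indicator (fun y => fderiv ℝ f x y) y) y ∂μ) (𝓝[>] 0)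
        (𝓝 (∫ y, (f x - f (x + y) +
          (Metric.ball (0 : 𝔼) 1).indicator (fun y => fderiv ℝ f x y) y) ∂μ)) := by
      refine tendsto_integral_filter_of_dominated_convergence _
        (.of_forall fun ε => (hG.indicator (hm ε)).aestronglyMeasurable)
        (.of_forall fun ε => .of_forall fun y => norm_indicator_le_norm_self _ _) hG.norm
        (.of_forall fun y => ?_)
      refine tendsto_const_nhds.congr' ?_
      rcases eq_or_ne y 0 with rfl | hne
      · refine .of_forall fun ε => ?_
        simp [Set.indicator]
      · filter_upwards [Ioo_mem_nhdsGT (norm_pos_iff.2 hne)] with ε hε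
        rw [Set.indicator_of_mem (show y ∈ {y : 𝔼 | ε ≤ ‖y‖} from hε.2.le)]
    refine hlim.congr' (eventually_mem_nhdsWithin.mono fun ε hε => ?_)
    have hε : 0 < ε := hε
    rw [integral_indicator (hm ε)]
    have hid : IntegrableOn (fun y : 𝔼 => y) ({y | ε ≤ ‖y‖} ∩ Metric.ball 0 1) μ := by
      refine Measure.integrableOn_of_bounded (M := 1) ?_ continuous_id.aestronglyMeasurable ?_
      · exact ((measure_mono Set.inter_subset_left).trans_lt
          (hμ.homogeneousKernel.measure_le_norm_lt_top hs hε)).ne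
      · refine (ae_restrict_mem ((hm ε).inter hball)).mono fun y hy => ?_
        exact (mem_ball_zero_iff.1 hy.2).le
    have hi : IntegrableOn ((Metric.ball (0 : 𝔼) 1).indicator fun y => fderiv ℝ f x y)
        {y | ε ≤ ‖y‖} μ := by
      rw [IntegrableOn, integrable_indicator_iff hball, IntegrableOn,
        Measure.restrict_restrict hball, Set.inter_comm]
      exact (fderiv ℝ f x).integrable_comp hid
    have hi2 : IntegrableOn (fun y => f x - f (x + y)) {y | ε ≤ ‖y‖} μ := by
      refine ((hG.integrableOn (s := {y : 𝔼 | ε ≤ ‖y‖})).sub hi).congr (.of_forall fun y => ?_)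
      exact add_sub_cancel_right _ _
    rw [integral_add hi2 hi, setIntegral_indicator hball, (fderiv ℝ f x).integral_comp_comm hid,
      hμ.integral_annulus_eq_zero heq hε, map_zero, add_zero]
  · have hid : IntegrableOn (fun y : 𝔼 => y) (Metric.ball 0 1)ᶜ μ := by
      refine (integrable_norm_iff continuous_id.aestronglyMeasurable).1 ?_
      simpa [IntegrableOn] using
        hμ.homogeneousKernel.integrableOn_norm_pow_compl_ball 1 (by push_cast; linarith)
    -- For s > 1/2 the gradient term outside the unit ball converges absolutely and becomes the
    -- drift.
    refine ⟨∫ y in (Metric.ball (0 : 𝔼) 1)ᶜ, y ∂μ, fun C f hf x => ?_⟩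
    have hi : Integrable ((Metric.ball (0 : 𝔼) 1)ᶜ.indicator fun y => fderiv ℝ f x y) μ :=
      (integrable_indicator_iff hball.compl).2 ((fderiv ℝ f x).integrable_comp hid)
    rw [op, if_neg hgt.not_gt, if_neg hgt.ne', levyOp, ← (fderiv ℝ f x).integral_comp_comm hid,
      ← integral_indicator hball.compl, ← integral_add (hf.integrable_increment hκ x) hi]
    refine integral_congr_ae (.of_forall fun y => ?_)
    simp only [add_assoc, Set.indicator_self_add_compl_apply]

end IsStableKernel

/-- Reflecting the test function turns the adjoint operator into the operator itself. -/
lemma adjointOp_comp_const_sub (s : ℝ) (b : 𝔼) (μ : Measure 𝔼) {f : 𝔼 → ℝ}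
    (hf : Differentiable ℝ f) (x z : 𝔼) :
    adjointOp s b μ (fun z => f (x - z)) z = op s b μ f (x - z) := by
  have hneg : MeasurableEmbedding fun y : 𝔼 => -y := (MeasurableEquiv.neg 𝔼).measurableEmbedding
  have hd : fderiv ℝ (fun z => f (x - z)) z = -fderiv ℝ f (x - z) := by
    have h := (hf (x - z)).hasFDerivAt.comp z ((hasFDerivAt_id z).const_sub x)
    exact h.fderiv.trans (by simp)
  have harg : ∀ y : 𝔼, x - (z + -y) = x - z + y := fun y => by abel
  simp only [adjointOp, op, adjointKernel, principalValue, hneg.integral_map,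
    hneg.setIntegral_map, hd, harg, neg_apply, map_neg, neg_neg, Set.preimage_ofPred_eq, norm_neg]

end Kernel

/-! ### From translation invariance to constancy. -/

section Liouville

variable {n : ℕ} {s lam Lam : ℝ} {μ : Measure (EuclideanSpace ℝ (Fin n))}

local notation "𝔼" => EuclideanSpace ℝ (Fin n)

lemma IsHomogeneousKernel.smul_mem_support (hμ : IsHomogeneousKernel s μ) {y : 𝔼}
    (hy : y ∈ μ.support) {t : ℝ} (ht : 0 < t) : t • y ∈ μ.support := by
  rw [Measure.mem_support_iff_forall] at hy ⊢
  intro V hV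
  obtain ⟨r, hr, hrV⟩ := Metric.mem_nhds_iff.1 hV
  have hpos : 0 < t⁻¹ * r := by positivity
  refine lt_of_lt_of_le ?_ (measure_mono (μ := μ)
    (show (fun z => t • z) '' Metric.ball y (t⁻¹ * r) ⊆ V from ?_))
  · rw [hμ.homogeneous t ht _ Metric.isOpen_ball.measurableSet]
    exact ENNReal.mul_pos (ENNReal.ofReal_pos.2 (by positivity)).ne'
      (hy _ (Metric.ball_mem_nhds y hpos)).ne'
  · rintro _ ⟨z, hz, rfl⟩
    refine hrV ?_
    rw [mem_ball_iff_norm] at hz ⊢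
    rw [← smul_sub, norm_smul, Real.norm_eq_abs, abs_of_pos ht]
    calc t * ‖z - y‖ < t * (t⁻¹ * r) := by gcongr
      _ = r := mul_inv_cancel_left₀ ht.ne' r

/-- Ellipticity: a linear functional which vanishes on the support of the kernel is zero. -/
lemma IsStableKernel.eq_zero_of_forall_mem_support (hμ : IsStableKernel s lam Lam μ) (hs : 0 < s)
    (L : 𝔼 →L[ℝ] ℝ) (hL : ∀ y ∈ μ.support, L y = 0) : L = 0 := by
  by_contra hne
  set v : 𝔼 := (InnerProductSpace.toDual ℝ 𝔼).symm L with hv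
  have hv0 : v ≠ 0 := by simpa [hv] using hne
  have hinner : ∀ y, inner ℝ v y = L y := fun y => by
    rw [hv, InnerProductSpace.toDual_symm_apply]
  have hlow := hμ.elliptic.lower (‖v‖⁻¹ • v) (norm_smul_inv_norm hv0)
  -- Almost every y lies in the support, where the normalised Riesz vector of L is orthogonal to y;
  -- this contradicts the lower ellipticity bound.
  have hzero : ∫⁻ θ, ENNReal.ofReal (|inner ℝ (‖v‖⁻¹ • v) θ| ^ (2 * s)) ∂(spherePart s μ) = 0 := by
    rw [spherePart, lintegral_smul_measure, lintegral_map (by fun_prop) (by fun_prop)]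
    refine smul_eq_zero_of_right _ ?_
    rw [lintegral_eq_zero_iff (by fun_prop)]
    refine ae_restrict_of_ae ?_
    filter_upwards [Measure.support_mem_ae (μ := μ)] with y hy
    have : inner ℝ (‖v‖⁻¹ • v) (‖y‖⁻¹ • y) = 0 := by
      rw [real_inner_smul_left, real_inner_smul_right, hinner, hL y hy]
      simp
    rw [this, abs_zero, Real.zero_rpow (by positivity)]
    simp
  rw [hzero, nonpos_iff_eq_zero, ENNReal.ofReal_eq_zero] at hlow
  exact hlow.not_gt hμ.elliptic.pos

/-- Liouville theorem for classical solutions. -/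
lemma IsStableKernel.apply_eq_of_levyOp_eq_zero (hμ : IsStableKernel s lam Lam μ)
    (hs : s ∈ Set.Ioo (0 : ℝ) 1) {C : ℝ} {f : 𝔼 → ℝ} (hf : BoundedC11 C f) {B : 𝔼}
    (h0 : ∀ x, levyOp B μ f x = 0) (x y : 𝔼) : f x = f y := by
  have hκ := hμ.homogeneousKernel.integrable_min_one_norm_sq hs
  refine is_const_of_fderiv_eq_zero hf.differentiable (fun x => ?_) x y
  refine hμ.eq_zero_of_forall_mem_support hs.1 _ fun y hy => ?_
  have hconst : ∀ t ∈ Set.Ici (0 : ℝ), f (x + t • y) = f x := by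
    intro t ht
    rcases (Set.mem_Ici.1 ht).eq_or_lt with rfl | ht
    · simp
    · refine hf.apply_add_eq_of_levyOp_eq_zero hκ h0 (fun r hr => ?_) x
      exact (Measure.mem_support_iff_forall _).1 (hμ.homogeneousKernel.smul_mem_support hy ht) _
        (Metric.ball_mem_nhds _ hr)
  -- The support is only a one-sided cone, so invariance is known for t ≥ 0; a right derivative at 0
  -- suffices.
  have h1 : HasDerivWithinAt (fun t : ℝ => f (x + t • y)) (fderiv ℝ f x y) (Set.Ici 0) 0 :=
    ((hf.differentiable x).hasFDerivAt.hasLineDerivAt y).hasDerivWithinAt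
  have h2 : HasDerivWithinAt (fun t : ℝ => f (x + t • y)) 0 (Set.Ici 0) 0 :=
    (hasDerivWithinAt_const 0 _ (f x)).congr hconst (hconst 0 Set.self_mem_Ici)
  exact (uniqueDiffWithinAt_Ici (0 : ℝ)).eq_deriv _ h1 h2

/-- The mollifications of a bounded weak solution are constant. -/
lemma IsWeakSolution.integral_mul_eq (hμ : IsStableKernel s lam Lam μ)
    (hs : s ∈ Set.Ioo (0 : ℝ) 1) {b : 𝔼} {u : 𝔼 → ℝ} (hu : MemLp u ⊤ volume)
    (hLu : IsWeakSolution s b μ Set.univ u (fun _ => 0)) {φ : 𝔼 → ℝ} (hφ : ContDiff ℝ ∞ φ)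
    (hc : HasCompactSupport φ) (x y : 𝔼) :
    ∫ z, u z * φ (x - z) = ∫ z, u z * φ (y - z) := by
  have : SigmaFinite μ := hμ.homogeneousKernel.sigmaFinite hs
  have hκ := hμ.homogeneousKernel.integrable_min_one_norm_sq hs
  have hM : ∀ᵐ z, |u z| ≤ (eLpNormEssSup u volume).toReal := by
    have hfin : eLpNormEssSup u volume ≠ ⊤ := by
      rw [← eLpNorm_exponent_top]
      exact hu.2.ne
    filter_upwards [ae_le_eLpNormEssSup (f := u) (μ := volume)] with z hz
    simpa using ENNReal.toReal_mono hfin hz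
  obtain ⟨B, hB⟩ := hμ.exists_op_eq_levyOp hs b
  obtain ⟨Cφ, hCφ⟩ := BoundedC11.of_contDiff_of_hasCompactSupport hφ hc
  obtain ⟨C, hC⟩ := exists_boundedC11_integral_mul hφ hc hu.1 hM
  refine hμ.apply_eq_of_levyOp_eq_zero hs hC (B := B) (fun x => ?_) x y
  rw [levyOp_integral_mul hφ hc hu.1 hM B hκ]
  -- Testing with the reflected translate of φ turns the weak equation into the vanishing of L(u *
  -- φ) at x.
  have h := hLu (fun z => φ (x - z)) (hφ.comp (contDiff_const.sub contDiff_id))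
    (hc.comp_homeomorph (Homeomorph.subLeft x)) (Set.subset_univ _)
  simp only [zero_mul, integral_zero, adjointOp_comp_const_sub s b μ hCφ.differentiable,
    hB Cφ φ hCφ] at h
  exact h

end Liouville

end StableOp

theorem theorem3p1 (n : ℕ) (s lam Lam : ℝ) (hs : s ∈ Set.Ioo (0 : ℝ) 1)
    (b : EuclideanSpace ℝ (Fin n)) (μ : Measure (EuclideanSpace ℝ (Fin n)))
    (hμ : StableOp.IsStableKernel s lam Lam μ)
    (u : EuclideanSpace ℝ (Fin n) → ℝ) (hu : MemLp u ⊤ volume)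
    (hLu : StableOp.IsWeakSolution s b μ Set.univ u (fun _ => 0)) :
    ∃ c : ℝ, u =ᵐ[volume] fun _ => c := by
  -- The outer radius is twice the inner one: a bounded ratio is what almost everywhere convergence
  -- of the mollifications requires.
  let ψ : ℕ → ContDiffBump (0 : EuclideanSpace ℝ (Fin n)) := fun k =>
    ⟨1 / ((k : ℝ) + 1), 2 * (1 / ((k : ℝ) + 1)), by positivity,
      by linarith [show (0 : ℝ) < 1 / ((k : ℝ) + 1) by positivity]⟩
  have hψ : Tendsto (fun k => (ψ k).rOut) atTop (𝓝 0) := by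
    have h := tendsto_one_div_add_atTop_nhds_zero_nat.const_mul (2 : ℝ)
    rw [mul_zero] at h
    exact h
  have hlim := ContDiffBump.ae_convolution_tendsto_right_of_locallyIntegrable (μ := volume)
    (φ := ψ) (K := 2) hψ (.of_forall fun k => le_rfl) (hu.locallyIntegrable le_top)
  have hconst : ∀ k x y, convolution ((ψ k).normed volume) u (ContinuousLinearMap.lsmul ℝ ℝ) volume x
      = convolution ((ψ k).normed volume) u (ContinuousLinearMap.lsmul ℝ ℝ) volume y := by
    intro k x y
    have h := StableOp.IsWeakSolution.integral_mul_eq hμ hs hu hLu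
      ((ψ k).contDiff_normed (μ := volume)) ((ψ k).hasCompactSupport_normed (μ := volume)) x y
    have hx : ∀ x, convolution ((ψ k).normed volume) u (ContinuousLinearMap.lsmul ℝ ℝ) volume x =
        ∫ z, u z * (ψ k).normed volume (x - z) := fun x => by
      rw [convolution_eq_swap]
      simp only [ContinuousLinearMap.lsmul_apply, smul_eq_mul, mul_comm]
    rw [hx, hx, h]
  obtain ⟨x₀, hx₀⟩ := hlim.exists
  refine ⟨u x₀, ?_⟩
  filter_upwards [hlim] with x hx
  exact tendsto_nhds_unique hx (hx₀.congr fun k => hconst k x₀ x)
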